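/- Let $n\in\mathbb N$, let $\Delta^n=\{p\in\mathbb R^n : p_i\ge 0,\ \sum_{i=1}^n p_i=1\}$, and let $\operatorname{int}(\Delta^n)=\{p\in\Delta^n : p_i>0 \text{ for all } i\}$. A loss function is a map $\ell=(\ell_1,\dots,\ell_n)\colon\Delta^n\to[0,\infty]^n$ with continuous components. It is admissible, $\ell\in\mathcal L_n$, if it is finite on $\operatorname{int}(\Delta^n)$, the image $\ell(\operatorname{int}(\Delta^n))\subset\mathbb R^n_{\ge0}$ is an embedded $(n-1)$-dimensional submanifold of $\mathbb R^n$ of class $C^2$, and there is a differentiable field $\mathbf n$ of normal vectors along $\ell(\operatorname{int}(\Delta^n))$ such that at every point $\mathbf n$ or $-\mathbf n$ lies in $\mathbb R^n_{>0}$. The loss is proper if $\langle \ell(p),p\rangle\le\langle\ell(q),p\rangle$ for all $p,q\in\Delta^n$ (with $0\cdot\infty=0$). Its conditional Bayes risk is $\underline L^{\ell}(p)=\inf_{q\in\Delta^n}\langle\ell(q),p\rangle$. Its superprediction set is $$\operatorname{spr}(\ell)=\{y\in[0,\infty)^n : \text{there is } q\in\Delta^n \text{ with } \ell_i(q)\le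 y_i \text{ for all } i\}.$$ For $\eta>0$, $\ell$ is $\eta$-mixable if the set $\{(e^{-\eta y_1},\dots,e^{-\eta y_n}) : y\in\operatorname{spr}(\ell)\}$ is convex. Let $\ell_{\log}(p)=(-\ln p_1,\dots,-\ln p_n)$, with $-\ln 0=\infty$, be the log loss. **Theorem.** Let $\ell\in\mathcal L_n$ be a proper loss and let $\eta>0$. Then $\ell$ is $\eta$-mixable if and only if the function $\eta\,\underline L^{\ell}-\underline L^{\ell_{\log}}$ is convex on $\operatorname{int}(\Delta^n)$. -/

import Mathlib

open scoped ENNReal Topology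

noncomputable section

/-- The (relative) interior of the probability simplex `Δ^n = stdSimplex ℝ (Fin n)`: the
probability vectors all of whose coordinates are positive. -/
def simplexInterior (n : ℕ) : Set (Fin n → ℝ) :=
  {p | p ∈ stdSimplex ℝ (Fin n) ∧ ∀ i, 0 < p i}

/-- A loss function on `Δ^n`, given by its partial losses `p ↦ ℓ p i`, each continuous on `Δ^n`.
Only the values on `Δ^n` matter. Values lie in `[0, ∞]`, so that the log loss, which is infinite at
some boundary points of the simplex, is a loss function; the losses with values in `[0, ∞)` are
special cases. -/
def IsLossFunction {n : ℕ} (ℓ : (Fin n → ℝ) → Fin n → ℝ≥0∞) : Prop :=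
  ∀ i, ContinuousOn (fun p => ℓ p i) (stdSimplex ℝ (Fin n))

/-- The conditional risk `L(p, q) = ⟨ℓ(q), p⟩`, for `p`, `q` in `Δ^n`
(with the usual convention `0 * ∞ = 0`). -/
def condRisk {n : ℕ} (ℓ : (Fin n → ℝ) → Fin n → ℝ≥0∞) (p q : Fin n → ℝ) : ℝ≥0∞ :=
  ∑ i, ENNReal.ofReal (p i) * ℓ q i

/-- The conditional Bayes risk `inf_{q ∈ Δ^n} L(p, q)`. -/
def bayesRisk {n : ℕ} (ℓ : (Fin n → ℝ) → Fin n → ℝ≥0∞) (p : Fin n → ℝ) : ℝ≥0∞ :=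
  ⨅ q ∈ stdSimplex ℝ (Fin n), condRisk ℓ p q

/-- Properness: for each `p` in `Δ^n`, the function `L(p, ·)` has a minimum over `Δ^n` at `p`. -/
def IsProper {n : ℕ} (ℓ : (Fin n → ℝ) → Fin n → ℝ≥0∞) : Prop :=
  ∀ p ∈ stdSimplex ℝ (Fin n), ∀ q ∈ stdSimplex ℝ (Fin n), condRisk ℓ p p ≤ condRisk ℓ p q

/-- The log loss `λ(p) = (-ln p_1, …, -ln p_n)`, where `-ln 0 = ∞`. -/
def logLoss (n : ℕ) (p : Fin n → ℝ) (i : Fin n) : ℝ≥0∞ :=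
  if p i = 0 then ⊤ else ENNReal.ofReal (-Real.log (p i))

/-- The superprediction set of `ℓ`, a subset of `[0, ∞)^n`. -/
def superpredictionSet {n : ℕ} (ℓ : (Fin n → ℝ) → Fin n → ℝ≥0∞) : Set (Fin n → ℝ) :=
  {y | (∀ i, 0 ≤ y i) ∧ ∃ q ∈ stdSimplex ℝ (Fin n), ∀ i, ℓ q i ≤ ENNReal.ofReal (y i)}

/-- The `η`-exponential projection. -/
def expProjection {n : ℕ} (η : ℝ) (y : Fin n → ℝ) : Fin n → ℝ :=
  fun i => Real.exp (-(η * y i))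

/-- `η`-mixability: the image of the superprediction set under the `η`-exponential projection is
convex. -/
def IsMixable {n : ℕ} (η : ℝ) (ℓ : (Fin n → ℝ) → Fin n → ℝ≥0∞) : Prop :=
  Convex ℝ (expProjection η '' superpredictionSet ℓ)

/-- `M` is an embedded `d`-dimensional submanifold of `ℝ^n` of class `C^2`: near each of its points
it is the image of a regular `C^2` parametrization `φ`, defined on an open subset `D` of `ℝ^d`,
which is a homeomorphism from `D` to a relatively open subset of `M` (with inverse `ψ`). -/
def IsC2Submanifold {n : ℕ} (d : ℕ) (M : Set (Fin n → ℝ)) : Prop :=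
  ∀ x ∈ M, ∃ (U : Set (Fin n → ℝ)) (D : Set (Fin d → ℝ))
    (φ : (Fin d → ℝ) → Fin n → ℝ) (ψ : (Fin n → ℝ) → Fin d → ℝ),
    IsOpen U ∧ x ∈ U ∧ IsOpen D ∧
    ContDiffOn ℝ 2 φ D ∧ (∀ u ∈ D, Function.Injective (fderiv ℝ φ u)) ∧
    φ '' D = M ∩ U ∧ ContinuousOn ψ (M ∩ U) ∧ ∀ u ∈ D, ψ (φ u) = u

/-- `w` is tangent to `M` at `y`: it is the velocity at `y` of a curve in `M`. -/
def IsTangentVector {n : ℕ} (M : Set (Fin n → ℝ)) (y w : Fin n → ℝ) : Prop :=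
  ∃ γ : ℝ → Fin n → ℝ, γ 0 = y ∧ (∀ᶠ t in 𝓝 (0 : ℝ), γ t ∈ M) ∧ HasDerivAt γ w 0

/-- `v` is normal to `M` at `y`: it is orthogonal to all tangent vectors of `M` at `y`. -/
def IsNormalVector {n : ℕ} (M : Set (Fin n → ℝ)) (y v : Fin n → ℝ) : Prop :=
  ∀ w, IsTangentVector M y w → v ⬝ᵥ w = 0

/-- The image under `ℓ` of the interior of the simplex, as a subset of `ℝ^n`
(for losses that are finite there). -/
def lossSurface {n : ℕ} (ℓ : (Fin n → ℝ) → Fin n → ℝ≥0∞) : Set (Fin n → ℝ) :=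
  (fun p i => (ℓ p i).toReal) '' simplexInterior n

/-- Admissible loss functions (the class `𝓛_n`): loss functions, finite on the interior of the
simplex, whose image of the interior is a `C^2` hypersurface with a differentiable field of
normal vectors `N` such that `N` or `-N` has only positive coordinates at each point. -/
structure IsAdmissible {n : ℕ} (ℓ : (Fin n → ℝ) → Fin n → ℝ≥0∞) : Prop where
  isLossFunction : IsLossFunction ℓ
  finite_on_interior : ∀ p ∈ simplexInterior n, ∀ i, ℓ p i ≠ ⊤
  submanifold : IsC2Submanifold (n - 1) (lossSurface ℓ)
  normal : ∃ N : (Fin n → ℝ) → Fin n → ℝ, DifferentiableOn ℝ N (lossSurface ℓ) ∧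
    ∀ y ∈ lossSurface ℓ, IsNormalVector (lossSurface ℓ) y (N y) ∧
      ((∀ i, 0 < N y i) ∨ (∀ i, 0 < -(N y i)))

end

open Filter

/-! On the interior the function in question is h(p) = η L(p) + ∑ p_i log p_i, where L is the Bayes
risk; by properness L(p) = ⟨p, ℓ(p)⟩.

If ℓ is mixable, h has at q the affine minorant with coefficients η ℓ_i(q) + log q_i. By Gibbs'
inequality it suffices that ∑ q_i exp(η(ℓ_i(q) - ℓ_i(p))) ≤ 1 (`IsMixable.sum_mul_exp_le_one`), the
first-order condition for moving from ℓ(q) towards ℓ(p) in the exponential projection.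

If h is convex, a mixture x = a e^{-ηy} + b e^{-ηz} splits q into posteriors r and s given its two
components. The chain rule for entropy and convexity of h at q, a convex combination of r and s,
give ⟨q, log x⟩ ≤ -η L(q) (`sum_mul_log_mix_le`). So -log x / η lies in every supporting half-space,
hence in the superprediction set (`mem_superpredictionSet_of_forall_sum_le`). -/

lemma simplexInterior_add_mem {n : ℕ} {p q : Fin n → ℝ} (hp : p ∈ simplexInterior n)
    (hq : q ∈ stdSimplex ℝ (Fin n)) {a b : ℝ} (ha : 0 < a) (hb : 0 ≤ b) (hab : a + b = 1) :
    a • p + b • q ∈ simplexInterior n := by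
  refine ⟨convex_stdSimplex ℝ (Fin n) hp.1 hq ha.le hb hab, fun i => ?_⟩
  have h1 := mul_pos ha (hp.2 i)
  have h2 := mul_nonneg hb (hq.1 i)
  simpa using add_pos_of_pos_of_nonneg h1 h2

lemma convex_simplexInterior (n : ℕ) : Convex ℝ (simplexInterior n) := by
  intro p hp q hq a b ha hb hab
  rcases ha.eq_or_lt with rfl | ha
  · obtain rfl : b = 1 := by linarith
    simpa using hq
  · exact simplexInterior_add_mem hp hq.1 ha hb hab

/-! ### Real-valued risks of proper losses. -/

lemma toReal_condRisk {n : ℕ} {ℓ : (Fin n → ℝ) → Fin n → ℝ≥0∞} {p q : Fin n → ℝ}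
    (hp : ∀ i, 0 ≤ p i) (hq : ∀ i, ℓ q i ≠ ⊤) :
    (condRisk ℓ p q).toReal = ∑ i, p i * (ℓ q i).toReal := by
  rw [condRisk, ENNReal.toReal_sum fun i _ => ENNReal.mul_ne_top ENNReal.ofReal_ne_top (hq i)]
  exact Finset.sum_congr rfl fun i _ => by rw [ENNReal.toReal_mul, ENNReal.toReal_ofReal (hp i)]

lemma IsProper.bayesRisk_eq {n : ℕ} {ℓ : (Fin n → ℝ) → Fin n → ℝ≥0∞} (h : IsProper ℓ)
    {p : Fin n → ℝ} (hp : p ∈ stdSimplex ℝ (Fin n)) : bayesRisk ℓ p = condRisk ℓ p p :=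
  le_antisymm (iInf₂_le p hp) (le_iInf₂ fun q hq => h p hp q hq)

lemma IsProper.toReal_bayesRisk {n : ℕ} {ℓ : (Fin n → ℝ) → Fin n → ℝ≥0∞} (h : IsProper ℓ)
    {p : Fin n → ℝ} (hp : p ∈ stdSimplex ℝ (Fin n)) (hfin : ∀ i, ℓ p i ≠ ⊤) :
    (bayesRisk ℓ p).toReal = ∑ i, p i * (ℓ p i).toReal := by
  rw [h.bayesRisk_eq hp, toReal_condRisk hp.1 hfin]

/-- Points of the superprediction set lie above all supporting hyperplanes. -/
lemma IsProper.sum_le_of_mem_superpredictionSet {n : ℕ} {ℓ : (Fin n → ℝ) → Fin n → ℝ≥0∞}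
    (h : IsProper ℓ) {p y : Fin n → ℝ} (hp : p ∈ stdSimplex ℝ (Fin n))
    (hfin : ∀ i, ℓ p i ≠ ⊤) (hy : y ∈ superpredictionSet ℓ) :
    ∑ i, p i * (ℓ p i).toReal ≤ ∑ i, p i * y i := by
  obtain ⟨hy0, q, hq, hqy⟩ := hy
  have hq' : ∀ i, ℓ q i ≠ ⊤ := fun i => ne_top_of_le_ne_top ENNReal.ofReal_ne_top (hqy i)
  have hfq : condRisk ℓ p q ≠ ⊤ :=
    ENNReal.sum_ne_top.2 fun i _ => ENNReal.mul_ne_top ENNReal.ofReal_ne_top (hq' i)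
  have h1 := ENNReal.toReal_mono hfq (h p hp q hq)
  rw [toReal_condRisk hp.1 hfin, toReal_condRisk hp.1 hq'] at h1
  refine h1.trans (Finset.sum_le_sum fun i _ => mul_le_mul_of_nonneg_left ?_ (hp.1 i))
  exact ENNReal.toReal_le_of_le_ofReal (hy0 i) (hqy i)

/-! ### Gibbs' inequality and the log loss. -/

/-- Gibbs' inequality, from log x ≤ x - 1 at x = q_i / p_i. Total mass below 1 is allowed for q, as
the subgradient inequality needs. -/
lemma sum_mul_log_le {n : ℕ} {p q : Fin n → ℝ} (hp : p ∈ simplexInterior n)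
    (hq : ∀ i, 0 < q i) (hq1 : ∑ i, q i ≤ 1) :
    ∑ i, p i * Real.log (q i) ≤ ∑ i, p i * Real.log (p i) := by
  have key : ∀ i, p i * Real.log (q i) - p i * Real.log (p i) ≤ q i - p i := fun i => by
    have h1 := Real.log_le_sub_one_of_pos (div_pos (hq i) (hp.2 i))
    rw [Real.log_div (hq i).ne' (hp.2 i).ne'] at h1
    have h2 := mul_le_mul_of_nonneg_left h1 (hp.2 i).le
    have h3 : p i * (q i / p i - 1) = q i - p i := by
      have := (hp.2 i).ne'
      field_simp
    linarith
  have h := Finset.sum_le_sum fun i (_ : i ∈ Finset.univ) => key i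
  rw [Finset.sum_sub_distrib, Finset.sum_sub_distrib, hp.1.2] at h
  linarith

lemma coord_le_one {n : ℕ} {p : Fin n → ℝ} (hp : p ∈ stdSimplex ℝ (Fin n)) (i : Fin n) :
    p i ≤ 1 := hp.2 ▸ Finset.single_le_sum (fun j _ => hp.1 j) (Finset.mem_univ i)

lemma logLoss_ne_top {n : ℕ} {p : Fin n → ℝ} (hp : ∀ i, 0 < p i) (i : Fin n) :
    logLoss n p i ≠ ⊤ := by
  simp [logLoss, (hp i).ne']

lemma toReal_logLoss {n : ℕ} {p : Fin n → ℝ} (hp : p ∈ simplexInterior n) (i : Fin n) :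
    (logLoss n p i).toReal = -Real.log (p i) := by
  rw [logLoss, if_neg (hp.2 i).ne', ENNReal.toReal_ofReal]
  exact neg_nonneg.2 (Real.log_nonpos (hp.2 i).le (coord_le_one hp.1 i))

lemma condRisk_logLoss_le {n : ℕ} {p q : Fin n → ℝ} (hp : p ∈ simplexInterior n)
    (hq : q ∈ stdSimplex ℝ (Fin n)) : condRisk (logLoss n) p p ≤ condRisk (logLoss n) p q := by
  by_cases h : ∀ i, 0 < q i
  · have hf : ∀ r : Fin n → ℝ, (∀ i, 0 < r i) → condRisk (logLoss n) p r ≠ ⊤ := fun r hr =>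
      ENNReal.sum_ne_top.2 fun i _ =>
        ENNReal.mul_ne_top ENNReal.ofReal_ne_top (logLoss_ne_top hr i)
    rw [← ENNReal.toReal_le_toReal (hf p hp.2) (hf q h),
      toReal_condRisk hp.1.1 (logLoss_ne_top hp.2), toReal_condRisk hp.1.1 (logLoss_ne_top h)]
    simp only [toReal_logLoss hp, toReal_logLoss ⟨hq, h⟩, mul_neg, Finset.sum_neg_distrib]
    exact neg_le_neg (sum_mul_log_le hp h hq.2.le)
  · push Not at h
    obtain ⟨i, hi⟩ := h
    have hi0 : q i = 0 := le_antisymm hi (hq.1 i)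
    have htop : condRisk (logLoss n) p q = ⊤ := by
      refine ENNReal.sum_eq_top.2 ⟨i, Finset.mem_univ i, ?_⟩
      rw [logLoss, if_pos hi0]
      exact ENNReal.mul_top (ENNReal.ofReal_pos.2 (hp.2 i)).ne'
    rw [htop]
    exact le_top

lemma toReal_bayesRisk_logLoss {n : ℕ} {p : Fin n → ℝ} (hp : p ∈ simplexInterior n) :
    (bayesRisk (logLoss n) p).toReal = -∑ i, p i * Real.log (p i) := by
  have h : bayesRisk (logLoss n) p = condRisk (logLoss n) p p :=
    le_antisymm (iInf₂_le p hp.1) (le_iInf₂ fun q hq => condRisk_logLoss_le hp hq)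
  rw [h, toReal_condRisk hp.1.1 (logLoss_ne_top hp.2)]
  simp only [toReal_logLoss hp, mul_neg, Finset.sum_neg_distrib]

/-! ### The superprediction set as an intersection of half-spaces. -/

/-- A continuous function on the interior of the simplex that dominates `-ε * log (p i)` for
each `i` has a minimum. -/
lemma exists_isMinOn_of_log_le {n : ℕ} (hn : 0 < n) {F : (Fin n → ℝ) → ℝ} {ε : ℝ} (hε : 0 < ε)
    (hF : ContinuousOn F (simplexInterior n))
    (hlog : ∀ p ∈ simplexInterior n, ∀ i, -(ε * Real.log (p i)) ≤ F p) :
    ∃ p ∈ simplexInterior n, IsMinOn F (simplexInterior n) p := by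
  have hn' : (0 : ℝ) < n := Nat.cast_pos.2 hn
  set u : Fin n → ℝ := fun _ => (n : ℝ)⁻¹ with hu
  have huS : u ∈ simplexInterior n := by
    refine ⟨⟨fun i => (inv_pos.2 hn').le, ?_⟩, fun i => inv_pos.2 hn'⟩
    simp [hu, hn'.ne']
  -- Solves -ε log δ = F u, so the sublevel set of F at the uniform point stays at distance δ from
  -- the faces.
  set δ : ℝ := Real.exp (-(F u / ε)) with hδ
  have hlow : ∀ p ∈ simplexInterior n, F p ≤ F u → ∀ i, δ ≤ p i := by
    intro p hp hpu i
    rw [hδ, ← Real.le_log_iff_exp_le (hp.2 i), neg_le, le_div_iff₀ hε]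
    have := hlog p hp i
    linarith
  set K : Set (Fin n → ℝ) := stdSimplex ℝ (Fin n) ∩ {p | ∀ i, δ ≤ p i} with hK
  have hKS : K ⊆ simplexInterior n := fun p hp =>
    ⟨hp.1, fun i => (Real.exp_pos _).trans_le (hp.2 i)⟩
  have hKc : IsCompact K := by
    refine (isCompact_stdSimplex ℝ (Fin n)).inter_right ?_
    simp only [Set.ofPred_forall]
    exact isClosed_iInter fun i => isClosed_le continuous_const (continuous_apply i)
  have huK : u ∈ K := ⟨huS.1, hlow u huS le_rfl⟩
  obtain ⟨p, hpK, hp⟩ := hKc.exists_isMinOn ⟨u, huK⟩ (hF.mono hKS)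
  refine ⟨p, hKS hpK, fun q hq => ?_⟩
  rcases le_total (F q) (F u) with h | h
  · exact hp ⟨hq.1, hlow q hq h⟩
  · exact (hp huK).trans h

/-- If `y` lies above all supporting hyperplanes of a proper loss `f`, then `f` is approximately
below `y` at some point. -/
lemma exists_le_add_of_forall_sum_le {n : ℕ} (hn : 0 < n) {f : (Fin n → ℝ) → Fin n → ℝ}
    (hf : ContinuousOn f (simplexInterior n))
    (hprop : ∀ p ∈ simplexInterior n, ∀ q ∈ simplexInterior n,
      ∑ i, p i * f p i ≤ ∑ i, p i * f q i)
    {y : Fin n → ℝ} (hy : ∀ p ∈ simplexInterior n, ∑ i, p i * f p i ≤ ∑ i, p i * y i)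
    {ε : ℝ} (hε : 0 < ε) : ∃ p ∈ simplexInterior n, ∀ i, f p i ≤ y i + n * ε := by
  have hfi : ∀ i, ContinuousOn (fun p => f p i) (simplexInterior n) :=
    fun i => (continuous_apply i).comp_continuousOn hf
  have hci : ∀ i, ContinuousOn (fun p : Fin n → ℝ => p i) (simplexInterior n) :=
    fun i => (continuous_apply i).continuousOn
  -- The gap ⟨p, y⟩ - L(p) plus a logarithmic barrier that forces an interior minimum.
  set F : (Fin n → ℝ) → ℝ := fun p =>
    ∑ i, (p i * (y i - f p i) - ε * Real.log (p i)) with hF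
  have hFc : ContinuousOn F (simplexInterior n) :=
    continuousOn_finsetSum _ fun i _ =>
      ((hci i).mul (continuousOn_const.sub (hfi i))).sub
        (continuousOn_const.mul ((hci i).log fun p hp => (hp.2 i).ne'))
  have hgap : ∀ p ∈ simplexInterior n, 0 ≤ ∑ i, p i * (y i - f p i) := fun p hp => by
    simp only [mul_sub, Finset.sum_sub_distrib]
    linarith [hy p hp]
  have hlog : ∀ p ∈ simplexInterior n, ∀ i, -(ε * Real.log (p i)) ≤ F p := by
    intro p hp i
    have h0 : ∀ j ∈ Finset.univ, 0 ≤ -(ε * Real.log (p j)) := fun j _ => by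
      have := mul_nonneg hε.le
        (neg_nonneg.2 (Real.log_nonpos (hp.2 j).le (coord_le_one hp.1 j)))
      linarith
    have h1 := Finset.single_le_sum h0 (Finset.mem_univ i)
    rw [Finset.sum_neg_distrib] at h1
    simp only [hF, Finset.sum_sub_distrib]
    linarith [hgap p hp]
  obtain ⟨q, hq, hmin⟩ := exists_isMinOn_of_log_le hn hε hFc hlog
  -- First-order condition at the minimum without differentiating f: properness bounds F (c t) - F q
  -- by t times a function continuous in c t; divide by t and let t → 0.
  have hfirst : ∀ r ∈ stdSimplex ℝ (Fin n),
      0 ≤ ∑ i, (r i - q i) * (y i - f q i - ε / q i) := by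
    intro r hr
    set c : ℝ → Fin n → ℝ := fun t => (1 - t) • q + t • r with hc
    have hcc : Continuous c := by fun_prop
    have hc0 : c 0 = q := by simp [hc]
    have hcS : ∀ t ∈ Set.Ico (0 : ℝ) 1, c t ∈ simplexInterior n := fun t ht =>
      simplexInterior_add_mem hq hr (by linarith [ht.2]) ht.1 (by ring)
    have hct : ∀ t i, c t i = q i + t * (r i - q i) := fun t i => by
      simp [hc]; ring
    have hnhds : Set.Ico (0 : ℝ) 1 ∈ 𝓝[>] (0 : ℝ) :=
      mem_of_superset (Ioo_mem_nhdsGT one_pos) Set.Ioo_subset_Ico_self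
    have hctend : Tendsto c (𝓝[>] 0) (𝓝[simplexInterior n] q) := by
      refine tendsto_nhdsWithin_iff.2 ⟨?_, mem_of_superset hnhds hcS⟩
      have := hcc.tendsto 0
      rw [hc0] at this
      exact this.mono_left nhdsWithin_le_nhds
    have hg : ContinuousOn (fun p : Fin n → ℝ => ∑ i, (r i - q i) * (y i - f p i - ε / p i))
        (simplexInterior n) :=
      continuousOn_finsetSum _ fun i _ => continuousOn_const.mul
        ((continuousOn_const.sub (hfi i)).sub
          (continuousOn_const.div (hci i) fun p hp => (hp.2 i).ne'))
    refine ge_of_tendsto ((hg q hq).tendsto.comp hctend) ?_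
    filter_upwards [Ioo_mem_nhdsGT (one_pos : (0 : ℝ) < 1)] with t ht
    have htS := hcS t ⟨ht.1.le, ht.2⟩
    have h1 : F q ≤ F (c t) := hmin htS
    have h2 := hprop q hq _ htS
    have h3 : ∀ i, Real.log (q i) - Real.log (c t i) ≤ -(t * (r i - q i) / c t i) := fun i => by
      have h := Real.log_le_sub_one_of_pos (div_pos (hq.2 i) (htS.2 i))
      rw [Real.log_div (hq.2 i).ne' (htS.2 i).ne'] at h
      have h' : q i / c t i - 1 = -(t * (r i - q i) / c t i) := by
        have := (htS.2 i).ne'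
        rw [div_sub_one this, ← neg_div]
        congr 1
        rw [hct]; ring
      linarith
    have h4 : F (c t) - F q ≤
        t * ∑ i, (r i - q i) * (y i - f (c t) i - ε / c t i) := by
      have h5 : F (c t) - F q + (∑ i, q i * f (c t) i - ∑ i, q i * f q i) ≤
          ∑ i, t * ((r i - q i) * (y i - f (c t) i - ε / c t i)) := by
        simp only [hF]
        rw [← Finset.sum_sub_distrib, ← Finset.sum_sub_distrib, ← Finset.sum_add_distrib]
        refine Finset.sum_le_sum fun i _ => ?_
        have h6 := mul_le_mul_of_nonneg_left (h3 i) hε.le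
        have h7 : ε * -(t * (r i - q i) / c t i) = -(t * ((r i - q i) * (ε / c t i))) := by ring
        rw [h7] at h6
        have h8 : c t i * (y i - f (c t) i) =
            q i * (y i - f (c t) i) + t * (r i - q i) * (y i - f (c t) i) := by
          rw [← add_mul, ← hct]
        rw [h8]
        linarith
      rw [Finset.mul_sum]
      linarith
    have h9 := h4.trans' (sub_nonneg.2 h1)
    exact (mul_nonneg_iff_of_pos_left ht.1).1 h9
  refine ⟨q, hq, fun i => ?_⟩
  -- Towards the i-th vertex: y_i - f_i(q) - ε/q_i is at least the gap minus nε, and the gap is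
  -- nonnegative.
  have h := hfirst _ (single_mem_stdSimplex ℝ i)
  have h1 : ∑ j, q j * (y j - f q j - ε / q j) = ∑ j, q j * (y j - f q j) - n * ε := by
    have : ∀ j, q j * (y j - f q j - ε / q j) = q j * (y j - f q j) - ε := fun j => by
      have := (hq.2 j).ne'
      field_simp
    simp [this, Finset.sum_sub_distrib]
  simp only [sub_mul] at h
  rw [Finset.sum_sub_distrib, h1] at h
  simp only [Pi.single_apply, ite_mul, one_mul, zero_mul, Finset.sum_ite_eq', Finset.mem_univ,
    if_true] at h
  have h2 := div_pos hε (hq.2 i)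
  have h3 := hgap q hq
  linarith

lemma continuousOn_toReal_loss {n : ℕ} {ℓ : (Fin n → ℝ) → Fin n → ℝ≥0∞}
    (hℓ : IsLossFunction ℓ) (hfin : ∀ p ∈ simplexInterior n, ∀ i, ℓ p i ≠ ⊤) :
    ContinuousOn (fun p i => (ℓ p i).toReal) (simplexInterior n) :=
  continuousOn_pi.2 fun i p hp => (ENNReal.tendsto_toReal (hfin p hp i)).comp
    ((hℓ i).mono (fun _ h => h.1) p hp)

/-- The superprediction set of a proper loss is the intersection of its supporting half-spaces. -/
lemma mem_superpredictionSet_of_forall_sum_le {n : ℕ} (hn : 0 < n)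
    {ℓ : (Fin n → ℝ) → Fin n → ℝ≥0∞} (hℓ : IsLossFunction ℓ)
    (hfin : ∀ p ∈ simplexInterior n, ∀ i, ℓ p i ≠ ⊤) (hprop : IsProper ℓ) {y : Fin n → ℝ}
    (hy0 : ∀ i, 0 ≤ y i)
    (hy : ∀ p ∈ simplexInterior n, ∑ i, p i * (ℓ p i).toReal ≤ ∑ i, p i * y i) :
    y ∈ superpredictionSet ℓ := by
  have hprop' : ∀ p ∈ simplexInterior n, ∀ q ∈ simplexInterior n,
      ∑ i, p i * (ℓ p i).toReal ≤ ∑ i, p i * (ℓ q i).toReal := fun p hp q hq =>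
    hprop.sum_le_of_mem_superpredictionSet hp.1 (hfin p hp)
      ⟨fun _ => ENNReal.toReal_nonneg, q, hq.1, fun i => (ENNReal.ofReal_toReal (hfin q hq i)).ge⟩
  have hex : ∀ m : ℕ, ∃ p ∈ simplexInterior n, ∀ i,
      (ℓ p i).toReal ≤ y i + n * (1 / ((m : ℝ) + 1)) := fun m =>
    exists_le_add_of_forall_sum_le hn (continuousOn_toReal_loss hℓ hfin) hprop' hy
      Nat.one_div_pos_of_nat
  choose p hpS hp using hex
  -- The limit q may lie on the boundary; continuity of ℓ into [0, ∞] still carries the bounds over.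
  obtain ⟨q, hq, φ, hφ, hlim⟩ :=
    (isCompact_stdSimplex ℝ (Fin n)).tendsto_subseq fun m => (hpS m).1
  refine ⟨hy0, q, hq, fun i => ?_⟩
  have hlim' : Tendsto (p ∘ φ) atTop (𝓝[stdSimplex ℝ (Fin n)] q) :=
    tendsto_nhdsWithin_iff.2 ⟨hlim, Eventually.of_forall fun m => (hpS _).1⟩
  have h1 : Tendsto (fun m => ℓ (p (φ m)) i) atTop (𝓝 (ℓ q i)) := (hℓ i q hq).tendsto.comp hlim'
  have h2 : Tendsto (fun m => ENNReal.ofReal (y i + n * (1 / ((φ m : ℝ) + 1)))) atTop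
      (𝓝 (ENNReal.ofReal (y i))) := by
    have h3 := (tendsto_one_div_add_atTop_nhds_zero_nat (𝕜 := ℝ)).comp hφ.tendsto_atTop
    have h4 := (h3.const_mul (n : ℝ)).const_add (y i)
    rw [mul_zero, add_zero] at h4
    exact ENNReal.tendsto_ofReal h4
  refine le_of_tendsto_of_tendsto' h1 h2 fun m => ?_
  rw [← ENNReal.ofReal_toReal (hfin _ (hpS (φ m)) i)]
  exact ENNReal.ofReal_le_ofReal (hp _ i)

/-! ### From mixability to convexity. -/

/-- The conclusion is the right derivative at t = 0 of the sum in `h`, which vanishes there; log x ≥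
1 - 1/x replaces differentiation. -/
lemma sum_mul_sub_one_nonpos {n : ℕ} {q d : Fin n → ℝ} (hq : ∀ i, 0 ≤ q i) (hd : ∀ i, 0 < d i)
    (h : ∀ t ∈ Set.Ioo (0 : ℝ) 1, ∑ i, q i * Real.log (1 - t + t * d i) ≤ 0) :
    ∑ i, q i * (d i - 1) ≤ 0 := by
  have hpos : ∀ t ∈ Set.Ioo (0 : ℝ) 1, ∀ i, 0 < 1 - t + t * d i := fun t ht i =>
    add_pos (by linarith [ht.2]) (mul_pos ht.1 (hd i))
  have hc : ContinuousAt (fun t : ℝ => ∑ i, q i * ((d i - 1) / (1 - t + t * d i))) 0 :=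
    tendsto_finsetSum _ fun i _ => by
      refine ContinuousAt.mul continuousAt_const (ContinuousAt.div continuousAt_const ?_ ?_)
      · fun_prop
      · simp
  have ht : Tendsto (fun t : ℝ => ∑ i, q i * ((d i - 1) / (1 - t + t * d i))) (𝓝[>] 0)
      (𝓝 (∑ i, q i * (d i - 1))) := by
    have := hc.tendsto.mono_left (nhdsWithin_le_nhds (s := Set.Ioi (0 : ℝ)))
    simpa using this
  refine le_of_tendsto ht ?_
  filter_upwards [Ioo_mem_nhdsGT (one_pos : (0 : ℝ) < 1)] with t ht
  have h1 : t * ∑ i, q i * ((d i - 1) / (1 - t + t * d i)) ≤ 0 := by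
    refine le_trans ?_ (h t ht)
    rw [Finset.mul_sum]
    refine Finset.sum_le_sum fun i _ => ?_
    have h2 := Real.one_sub_inv_le_log_of_pos (hpos t ht i)
    have h3 : 1 - (1 - t + t * d i)⁻¹ = t * ((d i - 1) / (1 - t + t * d i)) := by
      have := (hpos t ht i).ne'
      field_simp
      ring
    have h4 := mul_le_mul_of_nonneg_left h2 (hq i)
    rw [h3] at h4
    linarith
  exact nonpos_of_mul_nonpos_right h1 ht.1

/-- The exponential projection of a mixable proper loss is supported at the image of each
prediction. -/
lemma IsMixable.sum_mul_exp_le_one {n : ℕ} {ℓ : (Fin n → ℝ) → Fin n → ℝ≥0∞} {η : ℝ}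
    (hmix : IsMixable η ℓ) (hη : 0 < η) (hprop : IsProper ℓ)
    (hfin : ∀ p ∈ simplexInterior n, ∀ i, ℓ p i ≠ ⊤) {p q : Fin n → ℝ}
    (hp : p ∈ simplexInterior n) (hq : q ∈ simplexInterior n) :
    ∑ i, q i * Real.exp (η * ((ℓ q i).toReal - (ℓ p i).toReal)) ≤ 1 := by
  have hmem : ∀ r ∈ simplexInterior n, (fun i => (ℓ r i).toReal) ∈ superpredictionSet ℓ :=
    fun r hr => ⟨fun _ => ENNReal.toReal_nonneg, r, hr.1,
      fun i => (ENNReal.ofReal_toReal (hfin r hr i)).ge⟩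
  have h := sum_mul_sub_one_nonpos
    (d := fun i => Real.exp (η * ((ℓ q i).toReal - (ℓ p i).toReal)))
    hq.1.1 (fun i => Real.exp_pos _) fun t ht => ?_
  · simp only [mul_sub, Finset.sum_sub_distrib, mul_one, hq.1.2] at h ⊢
    linarith
  -- The mixture projects from a superprediction y, which lies above the supporting hyperplane at q.
  · obtain ⟨y, hy, hyt⟩ := hmix ⟨_, hmem q hq, rfl⟩ ⟨_, hmem p hp, rfl⟩
      (sub_nonneg.2 ht.2.le) ht.1.le (sub_add_cancel 1 t)
    have h1 := hprop.sum_le_of_mem_superpredictionSet hq.1 (hfin q hq) hy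
    have h2 : ∀ i, Real.log (1 - t + t * Real.exp (η * ((ℓ q i).toReal - (ℓ p i).toReal))) =
        η * ((ℓ q i).toReal - y i) := fun i => by
      have h3 := congrFun hyt i
      simp only [expProjection, Pi.add_apply, Pi.smul_apply, smul_eq_mul] at h3
      rw [← Real.log_exp (η * ((ℓ q i).toReal - y i))]
      congr 1
      have h4 : Real.exp (η * ((ℓ q i).toReal - y i)) =
          Real.exp (η * (ℓ q i).toReal) * Real.exp (-(η * y i)) := by
        rw [← Real.exp_add]; congr 1; ring
      have h5 : Real.exp (η * ((ℓ q i).toReal - (ℓ p i).toReal)) =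
          Real.exp (η * (ℓ q i).toReal) * Real.exp (-(η * (ℓ p i).toReal)) := by
        rw [← Real.exp_add]; congr 1; ring
      have h6 : Real.exp (η * (ℓ q i).toReal) * Real.exp (-(η * (ℓ q i).toReal)) = 1 := by
        rw [← Real.exp_add, add_neg_cancel, Real.exp_zero]
      rw [h4, h5, h3]
      linear_combination (-(1 - t)) * h6
    simp only [h2]
    have h7 : ∑ i, q i * (η * ((ℓ q i).toReal - y i)) =
        η * (∑ i, q i * (ℓ q i).toReal - ∑ i, q i * y i) := by
      rw [← Finset.sum_sub_distrib, Finset.mul_sum]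
      exact Finset.sum_congr rfl fun i _ => by ring
    rw [h7]
    exact mul_nonpos_of_nonneg_of_nonpos hη.le (by linarith)

/-- A function with an affine minorant touching it at each point is convex. -/
lemma convexOn_of_forall_sum_le {n : ℕ} {s : Set (Fin n → ℝ)} (hs : Convex ℝ s)
    {h : (Fin n → ℝ) → ℝ} (g : (Fin n → ℝ) → Fin n → ℝ)
    (heq : ∀ q ∈ s, h q = ∑ i, q i * g q i)
    (hle : ∀ q ∈ s, ∀ p ∈ s, ∑ i, p i * g q i ≤ h p) : ConvexOn ℝ s h := by
  refine ⟨hs, fun p hp q hq a b ha hb hab => ?_⟩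
  have hm := hs hp hq ha hb hab
  have h1 := mul_le_mul_of_nonneg_left (hle _ hm p hp) ha
  have h2 := mul_le_mul_of_nonneg_left (hle _ hm q hq) hb
  rw [heq _ hm]
  set v := g (a • p + b • q)
  have h3 : ∑ i, (a • p + b • q) i * v i = a * ∑ i, p i * v i + b * ∑ i, q i * v i := by
    rw [Finset.mul_sum, Finset.mul_sum, ← Finset.sum_add_distrib]
    exact Finset.sum_congr rfl fun i _ => by
      simp only [Pi.add_apply, Pi.smul_apply, smul_eq_mul]; ring
  rw [h3]
  exact add_le_add h1 h2

/-! ### From convexity to mixability. -/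

/-- The contribution of one component of a mixture: `u` is the posterior weight of the component,
given the outcome, and `r` is the posterior of `q`, given the component. -/
lemma exists_posterior {n : ℕ} {L : (Fin n → ℝ) → ℝ} {η : ℝ} (hη : 0 < η) {y : Fin n → ℝ}
    (hy : ∀ p ∈ simplexInterior n, L p ≤ ∑ i, p i * y i) {a : ℝ} (ha : 0 < a)
    {q u x : Fin n → ℝ} (hq : q ∈ simplexInterior n) (hu : ∀ i, 0 < u i)
    (hx : ∀ i, x i = Real.log a - η * y i - Real.log (u i)) :
    ∃ r ∈ simplexInterior n, (∀ i, (∑ j, q j * u j) * r i = q i * u i) ∧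
      ∑ i, q i * u i * x i ≤ a - ∑ j, q j * u j
        - (∑ j, q j * u j) * (η * L r + ∑ i, r i * Real.log (r i))
        + ∑ i, q i * u i * Real.log (q i) := by
  have hqu : ∀ i, 0 < q i * u i := fun i => mul_pos (hq.2 i) (hu i)
  have hne : (Finset.univ : Finset (Fin n)).Nonempty := by
    by_contra h
    have h1 := hq.1.2
    rw [Finset.not_nonempty_iff_eq_empty.1 h, Finset.sum_empty] at h1
    exact zero_ne_one h1
  set m := ∑ j, q j * u j with hm
  have hm0 : 0 < m := Finset.sum_pos (fun i _ => hqu i) hne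
  have hr0 : ∀ i, 0 < q i * u i / m := fun i => div_pos (hqu i) hm0
  have hr : (fun i => q i * u i / m) ∈ simplexInterior n :=
    ⟨⟨fun i => (hr0 i).le, by rw [← Finset.sum_div, ← hm, div_self hm0.ne']⟩, hr0⟩
  refine ⟨_, hr, fun i => mul_div_cancel₀ _ hm0.ne', ?_⟩
  have h1 : ∀ i, q i * u i * x i = q i * u i * (Real.log a - Real.log m)
      - m * (η * (q i * u i / m * y i) + q i * u i / m * Real.log (q i * u i / m))
      + q i * u i * Real.log (q i) := fun i => by
    rw [hx, Real.log_div (hqu i).ne' hm0.ne', Real.log_mul (hq.2 i).ne' (hu i).ne']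
    field_simp
    ring
  have h2 := mul_le_mul_of_nonneg_left (hy _ hr) (mul_pos hm0 hη).le
  -- The slack a - m cancels when both components are added, since the prior weights and the masses
  -- m each sum to 1.
  have h3 : m * (Real.log a - Real.log m) ≤ a - m := by
    have h4 := mul_le_mul_of_nonneg_left (Real.log_le_sub_one_of_pos (div_pos ha hm0)) hm0.le
    rwa [Real.log_div ha.ne' hm0.ne', mul_sub m (a / m), mul_div_cancel₀ _ hm0.ne', mul_one] at h4
  simp only [h1, Finset.sum_add_distrib, Finset.sum_sub_distrib, ← Finset.sum_mul,
    ← Finset.mul_sum, ← hm]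
  linarith

/-- Mixing preserves the lower bound `L` if `η L` plus the negative entropy is convex: the
mixture is analysed via the posteriors of `q` given each of its two components. -/
lemma sum_mul_log_mix_le {n : ℕ} {L : (Fin n → ℝ) → ℝ} {η : ℝ} (hη : 0 < η)
    (hconv : ConvexOn ℝ (simplexInterior n) fun p => η * L p + ∑ i, p i * Real.log (p i))
    {y z : Fin n → ℝ} (hy : ∀ p ∈ simplexInterior n, L p ≤ ∑ i, p i * y i)
    (hz : ∀ p ∈ simplexInterior n, L p ≤ ∑ i, p i * z i) {a b : ℝ} (ha : 0 < a) (hb : 0 < b)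
    (hab : a + b = 1) {q : Fin n → ℝ} (hq : q ∈ simplexInterior n) :
    ∑ i, q i * Real.log (a * Real.exp (-(η * y i)) + b * Real.exp (-(η * z i))) ≤
      -(η * L q) := by
  have hA : ∀ i, 0 < a * Real.exp (-(η * y i)) := fun i => mul_pos ha (Real.exp_pos _)
  have hB : ∀ i, 0 < b * Real.exp (-(η * z i)) := fun i => mul_pos hb (Real.exp_pos _)
  set x : Fin n → ℝ := fun i => a * Real.exp (-(η * y i)) + b * Real.exp (-(η * z i)) with hx
  have hx0 : ∀ i, 0 < x i := fun i => add_pos (hA i) (hB i)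
  set u : Fin n → ℝ := fun i => a * Real.exp (-(η * y i)) / x i with hu
  set v : Fin n → ℝ := fun i => b * Real.exp (-(η * z i)) / x i with hv
  have huv : ∀ i, u i + v i = 1 := fun i => by
    simp only [hu, hv]
    rw [← add_div]
    exact div_self (hx0 i).ne'
  have hq1 : ∀ i, q i * u i + q i * v i = q i := fun i => by rw [← mul_add, huv, mul_one]
  have hsplit : ∀ g : Fin n → ℝ,
      ∑ i, q i * g i = ∑ i, q i * u i * g i + ∑ i, q i * v i * g i := fun g => by
    rw [← Finset.sum_add_distrib]
    exact Finset.sum_congr rfl fun i _ => by rw [← add_mul, hq1]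
  obtain ⟨r, hr, hrq, hr'⟩ := exists_posterior (u := u) (x := fun i => Real.log (x i)) hη hy ha hq
    (fun i => div_pos (hA i) (hx0 i)) fun i => by
      rw [hu, Real.log_div (hA i).ne' (hx0 i).ne', Real.log_mul ha.ne' (Real.exp_ne_zero _),
        Real.log_exp]
      ring
  obtain ⟨s, hs, hsq, hs'⟩ := exists_posterior (u := v) (x := fun i => Real.log (x i)) hη hz hb hq
    (fun i => div_pos (hB i) (hx0 i)) fun i => by
      rw [hv, Real.log_div (hB i).ne' (hx0 i).ne', Real.log_mul hb.ne' (Real.exp_ne_zero _),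
        Real.log_exp]
      ring
  have hm : ∑ j, q j * u j + ∑ j, q j * v j = 1 := by
    rw [← Finset.sum_add_distrib, Finset.sum_congr rfl fun i _ => hq1 i, hq.1.2]
  have hcomb : (∑ j, q j * u j) • r + (∑ j, q j * v j) • s = q := by
    funext i
    simp only [Pi.add_apply, Pi.smul_apply, smul_eq_mul, hrq, hsq, hq1]
  have h := hconv.2 hr hs
    (Finset.sum_nonneg fun i _ => (mul_pos (hq.2 i) (div_pos (hA i) (hx0 i))).le)
    (Finset.sum_nonneg fun i _ => (mul_pos (hq.2 i) (div_pos (hB i) (hx0 i))).le) hm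
  rw [hcomb] at h
  simp only [smul_eq_mul] at h
  have h1 := hsplit fun i => Real.log (q i)
  have h2 := hsplit fun i => Real.log (x i)
  linarith

/-! ### The equivalence. -/

theorem mainTheorem2 (n : ℕ) (ℓ : (Fin n → ℝ) → Fin n → ENNReal)
    (hadm : IsAdmissible ℓ) (hproper : IsProper ℓ) (η : ℝ) (hη : 0 < η) :
    IsMixable η ℓ ↔
      ConvexOn ℝ (simplexInterior n)
        (fun p => η * (bayesRisk ℓ p).toReal - (bayesRisk (logLoss n) p).toReal) := by
  have hfin := hadm.finite_on_interior
  have hL : ∀ p ∈ simplexInterior n, (bayesRisk ℓ p).toReal = ∑ i, p i * (ℓ p i).toReal :=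
    fun p hp => hproper.toReal_bayesRisk hp.1 (hfin p hp)
  constructor
  · intro hmix
    refine convexOn_of_forall_sum_le (convex_simplexInterior n)
      (fun q i => η * (ℓ q i).toReal + Real.log (q i)) (fun q hq => ?_) fun q hq p hp => ?_
    · rw [hL q hq, toReal_bayesRisk_logLoss hq, sub_neg_eq_add, Finset.mul_sum,
        ← Finset.sum_add_distrib]
      exact Finset.sum_congr rfl fun i _ => by ring
    · have h1 := sum_mul_log_le hp
        (q := fun i => q i * Real.exp (η * ((ℓ q i).toReal - (ℓ p i).toReal)))
        (fun i => mul_pos (hq.2 i) (Real.exp_pos _))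
        (hmix.sum_mul_exp_le_one hη hproper hfin hp hq)
      have h2 : ∀ i, p i * Real.log (q i * Real.exp (η * ((ℓ q i).toReal - (ℓ p i).toReal))) =
          p i * (η * (ℓ q i).toReal + Real.log (q i)) - η * (p i * (ℓ p i).toReal) := fun i => by
        rw [Real.log_mul (hq.2 i).ne' (Real.exp_ne_zero _), Real.log_exp]
        ring
      simp only [h2, Finset.sum_sub_distrib, ← Finset.mul_sum] at h1
      rw [hL p hp, toReal_bayesRisk_logLoss hp]
      linarith
  · intro hconv
    have hconv' : ConvexOn ℝ (simplexInterior n)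
        fun p => η * (∑ i, p i * (ℓ p i).toReal) + ∑ i, p i * Real.log (p i) :=
      hconv.congr fun p hp => by
        simp only [hL p hp, toReal_bayesRisk_logLoss hp, sub_neg_eq_add]
    rcases Nat.eq_zero_or_pos n with rfl | hn
    · exact (Set.subsingleton_of_subsingleton).convex
    · refine convex_iff_forall_pos.2 ?_
      rintro _ ⟨y, hy, rfl⟩ _ ⟨z, hz, rfl⟩ a b ha hb hab
      have hx : ∀ i, 0 < a * Real.exp (-(η * y i)) + b * Real.exp (-(η * z i)) := fun i =>
        add_pos (mul_pos ha (Real.exp_pos _)) (mul_pos hb (Real.exp_pos _))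
      -- The preimage of the mixture under the exponential projection.
      refine ⟨fun i => -(Real.log (a * Real.exp (-(η * y i)) + b * Real.exp (-(η * z i))) / η),
        ?_, ?_⟩
      · refine mem_superpredictionSet_of_forall_sum_le hn hadm.isLossFunction hfin hproper
          (fun i => ?_) fun p hp => ?_
        · have h1 : Real.exp (-(η * y i)) ≤ 1 :=
            Real.exp_le_one_iff.2 (neg_nonpos.2 (mul_nonneg hη.le (hy.1 i)))
          have h2 : Real.exp (-(η * z i)) ≤ 1 :=
            Real.exp_le_one_iff.2 (neg_nonpos.2 (mul_nonneg hη.le (hz.1 i)))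
          refine neg_nonneg.2 (div_nonpos_of_nonpos_of_nonneg (Real.log_nonpos (hx i).le ?_) hη.le)
          have h3 := mul_le_mul_of_nonneg_left h1 ha.le
          have h4 := mul_le_mul_of_nonneg_left h2 hb.le
          linarith
        · have h1 := sum_mul_log_mix_le hη hconv'
            (fun r hr => hproper.sum_le_of_mem_superpredictionSet hr.1 (hfin r hr) hy)
            (fun r hr => hproper.sum_le_of_mem_superpredictionSet hr.1 (hfin r hr) hz) ha hb hab hp
          simp only [mul_neg, Finset.sum_neg_distrib, ← mul_div_assoc, ← Finset.sum_div]
          rw [le_neg, div_le_iff₀ hη]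
          linarith
      · funext i
        simp only [expProjection, Pi.add_apply, Pi.smul_apply, smul_eq_mul]
        rw [mul_neg, neg_neg, mul_div_cancel₀ _ hη.ne', Real.exp_log (hx i)]
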